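/- Let $A$ be a real $2\times 2$ matrix, $B\in\mathbb{R}^2$, and $f:\mathbb{R}^2\to\mathbb{R}^2$ a smooth map. Consider the planar control system $$\frac{dx}{dt}=Ax(t)+B\,w(t)+f(x(t)),$$ whose controls on $[0,T]$ are all smooth functions $w:[0,T]\to\mathbb{R}$. Suppose that the linear system $\frac{dx}{dt}=Ax+Bw$ is controllable, i.e. for all $p_0,p_1\in\mathbb{R}^2$ some smooth control steers it from $p_0$ to $p_1$ in some time $T$. Let $$m(A,B)=\min_{\lambda\in\mathbb{R}}\|AB-\lambda B\|,$$ where $\|\cdot\|$ is the Euclidean norm on $\mathbb{R}^2$ and the induced operator norm on matrices, and suppose that $$\sup_{x\in\mathbb{R}^2}\|Df(x)\|<\frac{m(A,B)}{\|B\|}.$$ Then: 1. For every $x\in\mathbb{R}^2$, the vector $B$ is not an eigenvector of $A+Df(x)$. 2. The system is locally controllable for every $T>0$ and every initial state $x_0\in\mathbb{R}^2$. That is: for each smooth control $w$ on $[0,T]$ there is exactly one solution $x$ on $[0,T]$ with $x(0)=x_0$, so that the end-point map $V_T[\,\cdot\,,x_0]: w\mapsto x(T)$ is well defined; this map is Fréchet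 differentiable on the space of smooth controls on $[0,T]$ with the supremum norm; and there are no singular controls, i.e. at every control $w$ its derivative $dV_T|_w$ maps the space of smooth controls onto $\mathbb{R}^2$. -/

import Mathlib

open scoped ContDiff

/-- The plane `ℝ²` with its Euclidean norm; linear maps of the plane carry the induced
(subordinate) operator norm. -/
abbrev Plane : Type := EuclideanSpace ℝ (Fin 2)

/-- The space of admissible controls on `[0, T]`: all smooth real functions on `[0, T]`
(restrictions of smooth functions on the line), with the supremum norm. -/
def SmoothControl (T : ℝ) : Submodule ℝ C(Set.Icc (0 : ℝ) T, ℝ) where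
  carrier := {w | ∃ u : ℝ → ℝ, ContDiff ℝ ∞ u ∧ ∀ t : Set.Icc (0 : ℝ) T, w t = u t}
  zero_mem' := ⟨fun _ => 0, contDiff_const, fun _ => rfl⟩
  add_mem' := by
    rintro w v ⟨u, hu, hwu⟩ ⟨z, hz, hvz⟩
    exact ⟨fun t => u t + z t, hu.add hz, fun t => by simp [hwu t, hvz t]⟩
  smul_mem' := by
    rintro c w ⟨u, hu, hwu⟩
    exact ⟨fun t => c * u t, contDiff_const.mul hu, fun t => by simp [hwu t]⟩

section ControlSystem

variable {E : Type*} [NormedAddCommGroup E] [NormedSpace ℝ E]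

/-- `x` solves `dx/dt = F(x(t), w(t))` on `[0, T]` with `x(0) = x₀`
(one-sided derivatives at the two ends of the interval). -/
def IsTrajectory (F : E → ℝ → E) (T : ℝ) (x₀ : E) (w : SmoothControl T) (x : ℝ → E) : Prop :=
  x 0 = x₀ ∧
    ∀ t : Set.Icc (0 : ℝ) T,
      HasDerivWithinAt x (F (x t) ((w : C(Set.Icc (0 : ℝ) T, ℝ)) t)) (Set.Icc 0 T) t

/-- For every control on `[0, T]` the initial value problem has a solution on all of `[0, T]`,
and any two solutions agree there; that is, the end-point map is well defined. -/
def HasUniqueTrajectories (F : E → ℝ → E) (T : ℝ) (x₀ : E) : Prop :=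
  ∀ w : SmoothControl T, ∃ x : ℝ → E, IsTrajectory F T x₀ w x ∧
    ∀ y : ℝ → E, IsTrajectory F T x₀ w y → Set.EqOn y x (Set.Icc 0 T)

open Classical in
/-- The end-point map `w ↦ V_T[w, x₀] = x(T)`, where `x` is the trajectory of the control `w`
that starts at `x₀` (and the value is `0` if there is no such trajectory). -/
noncomputable def endpointMap (F : E → ℝ → E) (T : ℝ) (x₀ : E) (w : SmoothControl T) : E :=
  if h : ∃ x : ℝ → E, IsTrajectory F T x₀ w x then h.choose T else 0

/-- The system can be steered from every state to every state, in some time, by some control. -/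
def IsGloballyControllable (F : E → ℝ → E) : Prop :=
  ∀ p₀ p₁ : E, ∃ T : ℝ, 0 ≤ T ∧ ∃ (w : SmoothControl T) (x : ℝ → E),
    IsTrajectory F T p₀ w x ∧ x T = p₁

/-- `w` is singular: the image of the derivative of the end-point map at `w` is not the whole
tangent space. -/
def IsSingularControl (F : E → ℝ → E) (T : ℝ) (x₀ : E) (w : SmoothControl T) : Prop :=
  ¬ Function.Surjective (fderiv ℝ (endpointMap F T x₀) w)

/-- Local controllability (local surjectivity): the end-point map is differentiable and there
are no singular controls. -/
def IsLocallyControllable (F : E → ℝ → E) (T : ℝ) (x₀ : E) : Prop :=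
  Differentiable ℝ (endpointMap F T x₀) ∧
    ∀ w : SmoothControl T, ¬ IsSingularControl F T x₀ w

end ControlSystem

/-- `m(A, B)`, the minimum of `‖A B - l B‖` over real `l`. -/
noncomputable def minGap (A : Plane →L[ℝ] Plane) (B : Plane) : ℝ :=
  ⨅ l : ℝ, ‖A B - l • B‖

/-- The infimum that defines `minGap` is a minimum, attained at `⟨B, A B⟩ / ‖B‖ ^ 2`. -/
theorem minGap_isMin (A : Plane →L[ℝ] Plane) (B : Plane) :
    minGap A B = ‖A B - (inner ℝ B (A B) / ‖B‖ ^ 2) • B‖ ∧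
      ∀ l : ℝ, minGap A B ≤ ‖A B - l • B‖ := by
  have hbdd : BddBelow (Set.range fun l : ℝ => ‖A B - l • B‖) :=
    ⟨0, by rintro _ ⟨l, rfl⟩; exact norm_nonneg _⟩
  refine ⟨le_antisymm (ciInf_le hbdd _) (le_ciInf fun l => ?_), fun l => ciInf_le hbdd l⟩
  by_cases hB : B = 0
  · simp [hB]
  have hn : ‖B‖ ^ 2 ≠ 0 := by simpa using hB
  set c : ℝ := inner ℝ B (A B) / ‖B‖ ^ 2 with hc
  have horth : inner ℝ (A B - c • B) ((c - l) • B) = 0 := by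
    rw [inner_smul_right, inner_sub_left, inner_smul_left, real_inner_self_eq_norm_sq,
      real_inner_comm, hc]
    simp [hn]
  have hsum : A B - l • B = (A B - c • B) + (c - l) • B := by module
  have hsq := norm_add_sq_eq_norm_sq_add_norm_sq_of_inner_eq_zero _ _ horth
  rw [← hsum] at hsq
  nlinarith [norm_nonneg (A B - c • B), norm_nonneg (A B - l • B), norm_nonneg ((c - l) • B)]

/-! If `A B + Df(x) B = γ B`, then `‖A B - γ B‖ = ‖Df(x) B‖ ≤ ‖Df(x)‖ ‖B‖ < m(A, B)`, against the
minimality of `m(A, B)`. So `B` and `DC(x) B` span the plane for every `x`, where `C = A + f`.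

The bound on `Df` makes `C` globally Lipschitz, which gives unique trajectories on all of `[0, T]`.
By Grönwall, the derivative of the end-point map in the direction `v` is `z(T)`, with `z` the
variation (`hasFDerivAt_endpointMap`).

If some `p ≠ 0` were orthogonal to the image, let `q` solve the adjoint equation with `q(T) = p`.
Duality (`inner_variation`) gives `∫ v ⟪q, B⟫ = 0` for all smooth `v`, so `⟪q, B⟫ = 0` inside the
interval; differentiating, `⟪q, DC(x) B⟫ = 0`. Hence `q` vanishes at an interior time, and so at
`T`: a contradiction. -/

/-! ### Global solutions of Lipschitz equations and Grönwall's inequality. -/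

section LipschitzODE

open Set MeasureTheory

open scoped NNReal Nat

variable {E : Type*} [NormedAddCommGroup E] [NormedSpace ℝ E]

/-- The Picard operator `α ↦ x₀ + ∫_{t₀}^t F(τ, α(τ)) dτ` on continuous curves on `[a, b]`. -/
noncomputable def picardOperator {a b : ℝ} (hab : a ≤ b) (F : ℝ → E → E)
    (hF : Continuous (Function.uncurry F)) (t₀ : ℝ) (x₀ : E) (α : C(Icc a b, E)) :
    C(Icc a b, E) where
  toFun t := x₀ + ∫ τ in t₀..t, F τ (α (projIcc a b hab τ))
  continuous_toFun := by
    have h : Continuous fun τ : ℝ => F τ (α (projIcc a b hab τ)) :=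
      hF.comp (continuous_id.prodMk (α.continuous.comp continuous_projIcc))
    exact continuous_const.add
      ((intervalIntegral.continuous_primitive (fun c d => h.intervalIntegrable c d) t₀).comp
        continuous_subtype_val)

/-- Each iteration integrates `|τ - t₀| ^ n` once more; this produces the factorial, so a high
iterate contracts on an interval of any length. -/
theorem dist_iterate_picardOperator_le {a b : ℝ} (hab : a ≤ b) {F : ℝ → E → E}
    (hF : Continuous (Function.uncurry F)) {K : ℝ≥0} (hK : ∀ t, LipschitzWith K (F t))
    {t₀ : ℝ} (ht₀ : t₀ ∈ Icc a b) (x₀ : E) (α β : C(Icc a b, E)) (n : ℕ) (t : Icc a b) :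
    dist ((picardOperator hab F hF t₀ x₀)^[n] α t) ((picardOperator hab F hF t₀ x₀)^[n] β t) ≤
      (K * |t.1 - t₀|) ^ n / n ! * dist α β := by
  have hcont (γ : C(Icc a b, E)) : Continuous fun τ : ℝ => F τ (γ (projIcc a b hab τ)) :=
    hF.comp (continuous_id.prodMk (γ.continuous.comp continuous_projIcc))
  induction n generalizing t with
  | zero => simpa using ContinuousMap.dist_apply_le_dist (f := α) (g := β) t
  | succ n hn =>
    rw [Function.iterate_succ_apply', Function.iterate_succ_apply', dist_eq_norm]
    set γ := (picardOperator hab F hF t₀ x₀)^[n] α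
    set δ := (picardOperator hab F hF t₀ x₀)^[n] β
    change ‖(x₀ + ∫ τ in t₀..t, F τ (γ (projIcc a b hab τ))) -
      (x₀ + ∫ τ in t₀..t, F τ (δ (projIcc a b hab τ)))‖ ≤ _
    rw [add_sub_add_left_eq_sub, ← intervalIntegral.integral_sub
      ((hcont γ).intervalIntegrable _ _) ((hcont δ).intervalIntegrable _ _)]
    calc
      _ ≤ ∫ τ in uIoc t₀ t.1, K ^ (n + 1) * |τ - t₀| ^ n / n ! * dist α β := by
        rw [intervalIntegral.norm_intervalIntegral_eq]
        apply norm_integral_le_of_norm_le (Continuous.integrableOn_uIoc (by fun_prop))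
        apply ae_restrict_mem measurableSet_Ioc |>.mono
        intro s hs
        have hs : s ∈ Icc a b := subset_trans uIoc_subset_uIcc (uIcc_subset_Icc ht₀ t.2) hs
        rw [← dist_eq_norm, projIcc_of_mem hab hs]
        calc _ ≤ K * dist (γ ⟨s, hs⟩) (δ ⟨s, hs⟩) := (hK s).dist_le_mul _ _
          _ ≤ K * ((K * |s - t₀|) ^ n / n ! * dist α β) := by gcongr; exact hn ⟨s, hs⟩
          _ = _ := by ring
      _ ≤ (K * |t.1 - t₀|) ^ (n + 1) / (n + 1) ! * dist α β := by
        apply le_of_abs_le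
        rw [← intervalIntegral.abs_intervalIntegral_eq, intervalIntegral.integral_mul_const,
          intervalIntegral.integral_div, intervalIntegral.integral_const_mul, abs_mul, abs_div,
          abs_mul, intervalIntegral.abs_intervalIntegral_eq, integral_pow_abs_sub_uIoc, abs_div,
          abs_pow, abs_pow, abs_dist, NNReal.abs_eq, abs_abs, mul_div, div_div, ← abs_mul,
          ← Nat.cast_succ, ← Nat.cast_mul, ← Nat.factorial_succ, Nat.abs_cast, ← mul_pow]

/-- A time-dependent vector field that is globally Lipschitz in space has a solution on all of
`[a, b]` through every initial value. -/
theorem exists_solution_of_lipschitzWith [CompleteSpace E] {a b : ℝ} (hab : a ≤ b)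
    {F : ℝ → E → E} (hF : Continuous (Function.uncurry F)) {K : ℝ≥0}
    (hK : ∀ t, LipschitzWith K (F t)) {t₀ : ℝ} (ht₀ : t₀ ∈ Icc a b) (x₀ : E) :
    ∃ x : ℝ → E, x t₀ = x₀ ∧ ∀ t ∈ Icc a b, HasDerivWithinAt x (F t (x t)) (Icc a b) t := by
  obtain ⟨n, hn⟩ := FloorSemiring.tendsto_pow_div_factorial_atTop ((K : ℝ) * (b - a))
    |>.eventually (gt_mem_nhds zero_lt_one) |>.exists
  have hnn : (0 : ℝ) ≤ (K * (b - a)) ^ n / n ! := by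
    have : 0 ≤ b - a := sub_nonneg.2 hab
    positivity
  have hcontr : ContractingWith ⟨_, hnn⟩ (picardOperator hab F hF t₀ x₀)^[n] := by
    refine ⟨hn, LipschitzWith.of_dist_le_mul fun α β => ?_⟩
    rw [ContinuousMap.dist_le (by positivity)]
    intro t
    refine (dist_iterate_picardOperator_le hab hF hK ht₀ x₀ α β n t).trans ?_
    change _ ≤ (K * (b - a)) ^ n / n ! * dist α β
    gcongr
    rw [abs_le]
    constructor <;> linarith [t.2.1, t.2.2, ht₀.1, ht₀.2]
  set α := ContractingWith.fixedPoint _ hcontr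
  -- The unique fixed point of a contracting iterate is fixed by the operator itself.
  have hα : picardOperator hab F hF t₀ x₀ α = α := hcontr.isFixedPt_fixedPoint_iterate
  have hcont : Continuous fun τ : ℝ => F τ (α (projIcc a b hab τ)) :=
    hF.comp (continuous_id.prodMk (α.continuous.comp continuous_projIcc))
  refine ⟨fun t => x₀ + ∫ τ in t₀..t, F τ (α (projIcc a b hab τ)), by simp, fun t ht => ?_⟩
  have hval : x₀ + ∫ τ in t₀..t, F τ (α (projIcc a b hab τ)) = α (projIcc a b hab t) := by
    rw [projIcc_of_mem hab ht]
    exact DFunLike.congr_fun hα ⟨t, ht⟩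
  beta_reduce
  rw [hval]
  exact ((hcont.integral_hasStrictDerivAt t₀ t).hasDerivAt.const_add x₀).hasDerivWithinAt

/-- Linearity in the forcing `ε` turns Grönwall bounds into estimates proportional to the size of
the control. -/
theorem gronwallBound_zero_eq_mul (K ε x : ℝ) :
    gronwallBound 0 K ε x = ε * gronwallBound 0 K 1 x := by
  unfold gronwallBound
  split_ifs <;> ring

/-- Grönwall's inequality for a curve with zero initial value. -/
theorem norm_le_mul_gronwallBound {T K ε : ℝ} (hK : 0 ≤ K) (hε : 0 ≤ ε) {x x' : ℝ → E}
    (hx : ∀ t ∈ Icc 0 T, HasDerivWithinAt x (x' t) (Icc 0 T) t) (hx0 : x 0 = 0)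
    (hbound : ∀ t ∈ Icc 0 T, ‖x' t‖ ≤ K * ‖x t‖ + ε) :
    ∀ t ∈ Icc 0 T, ‖x t‖ ≤ ε * gronwallBound 0 K 1 T := by
  intro t ht
  have h := norm_le_gronwallBound_of_norm_deriv_right_le (δ := 0)
    (fun t ht => (hx t ht).continuousWithinAt)
    (fun t ht => (hx t (Ico_subset_Icc_self ht)).mono_of_mem_nhdsWithin
      (Icc_mem_nhdsGE_of_mem ht)) (by simp [hx0])
    (fun t ht => hbound t (Ico_subset_Icc_self ht)) t ht
  refine h.trans ?_
  rw [sub_zero, ← gronwallBound_zero_eq_mul]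
  exact gronwallBound_mono le_rfl hε hK ht.2

end LipschitzODE

/-! ### Differentiability of the end-point map. -/

section EndpointDerivative

open Set

open scoped NNReal Topology

variable {E : Type*} [NormedAddCommGroup E] [NormedSpace ℝ E]

theorem SmoothControl.abs_apply_le {T : ℝ} (v : SmoothControl T) (t : Icc (0 : ℝ) T) :
    |(v : C(Icc (0 : ℝ) T, ℝ)) t| ≤ ‖(v : C(Icc (0 : ℝ) T, ℝ))‖ :=
  (v : C(Icc (0 : ℝ) T, ℝ)).norm_coe_le_norm t

theorem IsTrajectory.continuousOn {F : E → ℝ → E} {T : ℝ} {x₀ : E} {w : SmoothControl T}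
    {x : ℝ → E} (hx : IsTrajectory F T x₀ w x) : ContinuousOn x (Icc 0 T) :=
  fun t ht => (hx.2 ⟨t, ht⟩).continuousWithinAt

/-- Trajectories depend Lipschitz continuously on the control. -/
theorem IsTrajectory.norm_sub_le {C : E → E} {K : ℝ≥0} (hC : LipschitzWith K C) {B : E} {T : ℝ}
    {x₀ : E} {w v : SmoothControl T} {x y : ℝ → E}
    (hx : IsTrajectory (fun x u => C x + u • B) T x₀ w x)
    (hy : IsTrajectory (fun x u => C x + u • B) T x₀ v y) :
    ∀ t ∈ Icc 0 T, ‖y t - x t‖ ≤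
      ‖((v - w : SmoothControl T) : C(Icc (0 : ℝ) T, ℝ))‖ * ‖B‖ * gronwallBound 0 K 1 T := by
  intro t ht
  have hT : 0 ≤ T := ht.1.trans ht.2
  refine norm_le_mul_gronwallBound (x := fun s => y s - x s)
    (x' := fun s => (C (y s) + (v : C(Icc (0 : ℝ) T, ℝ)) (projIcc 0 T hT s) • B) -
      (C (x s) + (w : C(Icc (0 : ℝ) T, ℝ)) (projIcc 0 T hT s) • B))
    K.coe_nonneg (by positivity) (fun s hs => ?_) (by simp [hx.1, hy.1]) (fun s hs => ?_) t ht
  · rw [projIcc_of_mem hT hs]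
    exact (hy.2 ⟨s, hs⟩).sub (hx.2 ⟨s, hs⟩)
  · have h1 := hC.norm_sub_le (y s) (x s)
    have h2 := SmoothControl.abs_apply_le (v - w) (projIcc 0 T hT s)
    have e : (C (y s) + (v : C(Icc (0 : ℝ) T, ℝ)) (projIcc 0 T hT s) • B) -
        (C (x s) + (w : C(Icc (0 : ℝ) T, ℝ)) (projIcc 0 T hT s) • B) =
        (C (y s) - C (x s)) +
          ((v - w : SmoothControl T) : C(Icc (0 : ℝ) T, ℝ)) (projIcc 0 T hT s) • B := by
      simp only [Submodule.coe_sub, ContinuousMap.sub_apply]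
      module
    rw [e]
    refine (norm_add_le _ _).trans (add_le_add h1 ?_)
    rw [norm_smul, Real.norm_eq_abs]
    gcongr

/-- Uniqueness is Lipschitz dependence on the control, applied to two equal controls. -/
theorem hasUniqueTrajectories_of_lipschitzWith [CompleteSpace E] {C : E → E} {K : ℝ≥0}
    (hC : LipschitzWith K C) (B : E) {T : ℝ} (hT : 0 ≤ T) (x₀ : E) :
    HasUniqueTrajectories (fun x u => C x + u • B) T x₀ := by
  intro w
  obtain ⟨x, hx0, hx⟩ := exists_solution_of_lipschitzWith hT
    (F := fun t x => C x + (w : C(Icc (0 : ℝ) T, ℝ)) (projIcc 0 T hT t) • B) (K := K)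
    (by
      have h := (w : C(Icc (0 : ℝ) T, ℝ)).continuous.comp (continuous_projIcc (h := hT))
      exact (hC.continuous.comp continuous_snd).add ((h.comp continuous_fst).smul continuous_const))
    (fun t => LipschitzWith.of_dist_le_mul fun y z => by
      rw [dist_add_right]
      exact hC.dist_le_mul y z) (left_mem_Icc.2 hT) x₀
  have hxt : IsTrajectory (fun x u => C x + u • B) T x₀ w x := by
    refine ⟨hx0, fun t => ?_⟩
    have h := hx t t.2
    rwa [projIcc_of_mem hT t.2] at h
  refine ⟨x, hxt, fun y hy t ht => ?_⟩
  have h := hxt.norm_sub_le hC hy t ht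
  rw [sub_self, Submodule.coe_zero, norm_zero, zero_mul, zero_mul] at h
  exact sub_eq_zero.1 (norm_le_zero_iff.1 h)

theorem HasUniqueTrajectories.endpointMap_eq {F : E → ℝ → E} {T : ℝ} (hT : 0 ≤ T) {x₀ : E}
    (hF : HasUniqueTrajectories F T x₀) {w : SmoothControl T} {x : ℝ → E}
    (hx : IsTrajectory F T x₀ w x) : endpointMap F T x₀ w = x T := by
  have h : ∃ x : ℝ → E, IsTrajectory F T x₀ w x := ⟨x, hx⟩
  obtain ⟨y, -, hy⟩ := hF w
  rw [endpointMap, dif_pos h, hy _ h.choose_spec (right_mem_Icc.2 hT),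
    hy x hx (right_mem_Icc.2 hT)]

/-- `z` solves the linearization of `dx/dt = C(x) + w B` along the curve `x`, in the direction `v`
of the control: `dz/dt = DC(x(t)) z + v(t) B` with `z(0) = 0`. -/
def IsVariation (C : E → E) (B : E) (T : ℝ) (x : ℝ → E) (v : SmoothControl T) (z : ℝ → E) :
    Prop :=
  z 0 = 0 ∧ ∀ t : Icc (0 : ℝ) T,
    HasDerivWithinAt z (fderiv ℝ C (x t) (z t) + (v : C(Icc (0 : ℝ) T, ℝ)) t • B) (Icc 0 T) t

namespace IsVariation

variable {C : E → E} {B : E} {T : ℝ} {x : ℝ → E} {v w : SmoothControl T} {z y : ℝ → E}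

theorem continuousOn (hz : IsVariation C B T x v z) : ContinuousOn z (Icc 0 T) :=
  fun t ht => (hz.2 ⟨t, ht⟩).continuousWithinAt

theorem add (hz : IsVariation C B T x v z) (hy : IsVariation C B T x w y) :
    IsVariation C B T x (v + w) (z + y) := by
  refine ⟨by simp [hz.1, hy.1], fun t => ((hz.2 t).add (hy.2 t)).congr_deriv ?_⟩
  simp only [Pi.add_apply, map_add, Submodule.coe_add, ContinuousMap.add_apply]
  module

theorem smul (c : ℝ) (hz : IsVariation C B T x v z) : IsVariation C B T x (c • v) (c • z) := by
  refine ⟨by simp [hz.1], fun t => ((hz.2 t).const_smul c).congr_deriv ?_⟩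
  simp only [Pi.smul_apply, map_smul, Submodule.coe_smul, ContinuousMap.smul_apply, smul_eq_mul]
  module

theorem norm_le {K : ℝ≥0} (hC : LipschitzWith K C) (hz : IsVariation C B T x v z) :
    ∀ t ∈ Icc 0 T, ‖z t‖ ≤
      ‖(v : C(Icc (0 : ℝ) T, ℝ))‖ * ‖B‖ * gronwallBound 0 K 1 T := by
  intro t ht
  have hT : 0 ≤ T := ht.1.trans ht.2
  refine norm_le_mul_gronwallBound
    (x' := fun s => fderiv ℝ C (x s) (z s) +
      (v : C(Icc (0 : ℝ) T, ℝ)) (projIcc 0 T hT s) • B)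
    K.coe_nonneg (by positivity) (fun s hs => ?_) hz.1 (fun s hs => ?_) t ht
  · rw [projIcc_of_mem hT hs]
    exact hz.2 ⟨s, hs⟩
  · refine (norm_add_le _ _).trans (add_le_add ?_ ?_)
    · exact (ContinuousLinearMap.le_opNorm _ _).trans
        (mul_le_mul_of_nonneg_right (norm_fderiv_le_of_lipschitz ℝ hC) (norm_nonneg _))
    · rw [norm_smul, Real.norm_eq_abs]
      gcongr
      exact SmoothControl.abs_apply_le v _

theorem eqOn {K : ℝ≥0} (hC : LipschitzWith K C) (hz : IsVariation C B T x v z)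
    (hy : IsVariation C B T x v y) : EqOn z y (Icc 0 T) := by
  intro t ht
  have h := (hz.add (hy.smul (-1))).norm_le hC t ht
  rw [show v + (-1 : ℝ) • v = 0 by module, Submodule.coe_zero, norm_zero, zero_mul, zero_mul] at h
  have h' := norm_le_zero_iff.1 h
  simp only [Pi.add_apply, neg_smul, one_smul] at h'
  exact add_neg_eq_zero.1 h'

theorem exists_of_continuousOn [CompleteSpace E] (hC1 : ContDiff ℝ 1 C) {K : ℝ≥0}
    (hC : LipschitzWith K C) (B : E) (hT : 0 ≤ T) (hx : ContinuousOn x (Icc 0 T))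
    (v : SmoothControl T) : ∃ z, IsVariation C B T x v z := by
  have hL : Continuous fun t => fderiv ℝ C (x (projIcc 0 T hT t)) :=
    (hC1.continuous_fderiv one_ne_zero).comp
      (hx.comp_continuous (continuous_subtype_val.comp continuous_projIcc) fun t => Subtype.prop _)
  obtain ⟨z, hz0, hz⟩ := exists_solution_of_lipschitzWith hT
    (F := fun t z => fderiv ℝ C (x (projIcc 0 T hT t)) z +
      (v : C(Icc (0 : ℝ) T, ℝ)) (projIcc 0 T hT t) • B) (K := K)
    (by
      have h := (v : C(Icc (0 : ℝ) T, ℝ)).continuous.comp (continuous_projIcc (h := hT))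
      exact ((hL.comp continuous_fst).clm_apply continuous_snd).add
        ((h.comp continuous_fst).smul continuous_const))
    (fun t => LipschitzWith.of_dist_le_mul fun y z => by
      rw [dist_add_right, dist_eq_norm, dist_eq_norm, ← map_sub]
      exact (ContinuousLinearMap.le_opNorm _ _).trans
        (mul_le_mul_of_nonneg_right (norm_fderiv_le_of_lipschitz ℝ hC) (norm_nonneg _)))
    (left_mem_Icc.2 hT) 0
  refine ⟨z, hz0, fun t => ?_⟩
  have h := hz t t.2
  rwa [projIcc_of_mem hT t.2] at h

end IsVariation

/-- The linear map `v ↦ z(T)`, where `z` is the variation in the direction `v`. -/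
theorem exists_variationEndpoint [CompleteSpace E] {C : E → E} (hC1 : ContDiff ℝ 1 C) {K : ℝ≥0}
    (hC : LipschitzWith K C) (B : E) {T : ℝ} (hT : 0 ≤ T) {x : ℝ → E}
    (hx : ContinuousOn x (Icc 0 T)) :
    ∃ D : SmoothControl T →L[ℝ] E, ∀ v z, IsVariation C B T x v z → D v = z T := by
  choose z hz using IsVariation.exists_of_continuousOn hC1 hC B hT hx
  have hmem : T ∈ Icc 0 T := right_mem_Icc.2 hT
  let D₀ : SmoothControl T →ₗ[ℝ] E :=
    { toFun := fun v => z v T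
      map_add' := fun v w => ((hz (v + w)).eqOn hC ((hz v).add (hz w)) hmem)
      map_smul' := fun c v => ((hz (c • v)).eqOn hC ((hz v).smul c) hmem) }
  refine ⟨D₀.mkContinuous (‖B‖ * gronwallBound 0 K 1 T) fun v => ?_, fun v y hy => ?_⟩
  · refine ((hz v).norm_le hC T hmem).trans (le_of_eq ?_)
    exact (mul_assoc _ _ _).trans (mul_comm _ _)
  · exact (hz v).eqOn hC hy hmem

/-- A `C¹` map is differentiable uniformly along a compact set. -/
theorem exists_forall_norm_sub_sub_fderiv_le {C : E → E} (hC1 : ContDiff ℝ 1 C) {s : Set E}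
    (hs : IsCompact s) {ε : ℝ} (hε : 0 < ε) :
    ∃ δ > 0, ∀ p ∈ s, ∀ q, ‖q - p‖ < δ →
      ‖C q - C p - fderiv ℝ C p (q - p)‖ ≤ ε * ‖q - p‖ := by
  -- Only one of the two points compared has to lie in `s`, so the ball around `p` may leave `s`.
  have h := hs.uniformContinuousAt_of_continuousAt (fderiv ℝ C)
    (fun p _ => (hC1.continuous_fderiv one_ne_zero).continuousAt) (Metric.dist_mem_uniformity hε)
  obtain ⟨δ, hδ, hsub⟩ := Metric.mem_uniformity_dist.1 h
  refine ⟨δ, hδ, fun p hp q hq => ?_⟩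
  refine (convex_ball p δ).norm_image_sub_le_of_norm_fderiv_le'
    (fun r _ => hC1.differentiable one_ne_zero r) (fun r hr => ?_) (Metric.mem_ball_self hδ)
    (by rwa [mem_ball_iff_norm])
  have h' : dist (fderiv ℝ C p) (fderiv ℝ C r) < ε := hsub (by rwa [dist_comm]) hp
  rw [← dist_eq_norm, dist_comm]
  exact h'.le

/-- The remainder `y - x - z` starts at `0` and solves the linearized equation with forcing `C(y) -
C(x) - DC(x)(y - x)`. This is at most `ε ‖y - x‖` near the compact trajectory, and `‖y - x‖` is of
order `‖v - w‖`; Grönwall concludes. -/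
theorem hasFDerivAt_endpointMap [CompleteSpace E] {C : E → E} (hC1 : ContDiff ℝ 1 C) {K : ℝ≥0}
    (hC : LipschitzWith K C) {B : E} {T : ℝ} (hT : 0 ≤ T) {x₀ : E} {w : SmoothControl T}
    {x : ℝ → E} (hx : IsTrajectory (fun x u => C x + u • B) T x₀ w x)
    {D : SmoothControl T →L[ℝ] E} (hD : ∀ v z, IsVariation C B T x v z → D v = z T) :
    HasFDerivAt (endpointMap (fun x u => C x + u • B) T x₀) D w := by
  have hU := hasUniqueTrajectories_of_lipschitzWith hC B hT x₀
  have hmem : T ∈ Icc 0 T := right_mem_Icc.2 hT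
  refine HasFDerivAt.of_isLittleO (𝕜 := ℝ) (E := SmoothControl T) (F := E) (f' := D) ?_
  rw [Asymptotics.isLittleO_iff]
  intro c hc
  set G := gronwallBound 0 (K : ℝ) 1 T with hG
  have hG0 : 0 ≤ G := by
    have h := gronwallBound_mono (le_refl (0 : ℝ)) (zero_le_one (α := ℝ)) K.coe_nonneg hT
    rwa [gronwallBound_x0] at h
  -- One factor `G` comes from `‖y - x‖`, the other from Grönwall for the remainder; the `+ 1` keeps
  -- the denominator positive.
  set ε := c / (‖B‖ * G * G + 1) with hεd
  have hε : 0 < ε := by positivity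
  obtain ⟨δ, hδ, hCδ⟩ := exists_forall_norm_sub_sub_fderiv_le hC1
    (isCompact_Icc.image_of_continuousOn hx.continuousOn) hε
  have hnear : ∀ᶠ v in 𝓝 w,
      ‖((v - w : SmoothControl T) : C(Icc (0 : ℝ) T, ℝ))‖ * ‖B‖ * G < δ := by
    have hcont : Continuous fun v : SmoothControl T =>
        ‖((v - w : SmoothControl T) : C(Icc (0 : ℝ) T, ℝ))‖ * ‖B‖ * G := by fun_prop
    exact hcont.continuousAt.eventually_lt continuousAt_const (by simpa using hδ)
  filter_upwards [hnear] with v hv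
  change _ ≤ c * ‖((v - w : SmoothControl T) : C(Icc (0 : ℝ) T, ℝ))‖
  set r := ‖((v - w : SmoothControl T) : C(Icc (0 : ℝ) T, ℝ))‖ with hr
  have hr0 : 0 ≤ r := norm_nonneg _
  obtain ⟨y, hy, -⟩ := hU v
  obtain ⟨z, hz⟩ := IsVariation.exists_of_continuousOn hC1 hC B hT hx.continuousOn (v - w)
  rw [hU.endpointMap_eq hT hx, hU.endpointMap_eq hT hy, hD _ _ hz]
  have hyx := hx.norm_sub_le hC hy
  have hmain := norm_le_mul_gronwallBound (T := T) (x := fun s => y s - x s - z s)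
    (x' := fun s => C (y s) - C (x s) - fderiv ℝ C (x s) (z s))
    K.coe_nonneg (ε := ε * (r * ‖B‖ * G)) (by positivity) (fun s hs => ?_)
    (by simp [hx.1, hy.1, hz.1]) (fun s hs => ?_) T hmem
  · refine hmain.trans ?_
    rw [← hG]
    have h1 : ε * (‖B‖ * G * G) ≤ c := by
      rw [hεd, div_mul_eq_mul_div, div_le_iff₀ (by positivity)]
      nlinarith
    calc ε * (r * ‖B‖ * G) * G = ε * (‖B‖ * G * G) * r := by ring
      _ ≤ c * r := by gcongr
  · refine (((hy.2 ⟨s, hs⟩).sub (hx.2 ⟨s, hs⟩)).sub (hz.2 ⟨s, hs⟩)).congr_deriv ?_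
    simp only [Submodule.coe_sub, ContinuousMap.sub_apply]
    module
  · have hs' := hyx s hs
    have e : C (y s) - C (x s) - fderiv ℝ C (x s) (z s) =
        fderiv ℝ C (x s) (y s - x s - z s) +
          (C (y s) - C (x s) - fderiv ℝ C (x s) (y s - x s)) := by
      rw [map_sub _ (y s - x s)]
      abel
    rw [e]
    refine (norm_add_le _ _).trans (add_le_add ?_ ?_)
    · exact (ContinuousLinearMap.le_opNorm _ _).trans
        (mul_le_mul_of_nonneg_right (norm_fderiv_le_of_lipschitz ℝ hC) (norm_nonneg _))
    · refine (hCδ (x s) (mem_image_of_mem x hs) (y s) (hs'.trans_lt hv)).trans ?_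
      gcongr

end EndpointDerivative

/-! ### Adjoint curves and absence of singular controls. -/

section Controllability

open Set MeasureTheory

open scoped NNReal Topology InnerProductSpace

/-- A continuous function on `[0, T]` that is orthogonal to all smooth controls vanishes in the
interior. -/
theorem eqOn_zero_of_forall_integral_smoothControl {T : ℝ} (hT : 0 ≤ T) {g : ℝ → ℝ}
    (hg : ContinuousOn g (Icc 0 T))
    (h : ∀ v : SmoothControl T,
      ∫ t in (0 : ℝ)..T, (v : C(Icc (0 : ℝ) T, ℝ)) (projIcc 0 T hT t) * g t = 0) :
    EqOn g 0 (Ioo 0 T) := by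
  have hg' : ContinuousOn g (Ioo 0 T) := hg.mono Ioo_subset_Icc_self
  refine Measure.eqOn_open_of_ae_eq (μ := volume) ?_ isOpen_Ioo hg' continuousOn_const
  refine (ae_restrict_iff' measurableSet_Ioo).2 ?_
  -- Test functions supported in `(0, T)` restrict to smooth controls.
  refine isOpen_Ioo.ae_eq_zero_of_integral_contDiff_smul_eq_zero
    (hg'.locallyIntegrableOn measurableSet_Ioo) fun u hu _ hsupp => ?_
  have hv := h ⟨⟨fun t => u t, hu.continuous.comp continuous_subtype_val⟩, u, hu, fun _ => rfl⟩
  rw [intervalIntegral.integral_of_le hT] at hv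
  rw [← hv, ← setIntegral_eq_integral_of_forall_compl_eq_zero (s := Ioc 0 T)]
  · refine setIntegral_congr_fun measurableSet_Ioc fun t ht => ?_
    have e : ((projIcc 0 T hT t : Icc (0 : ℝ) T) : ℝ) = t := by
      rw [projIcc_of_mem hT (Ioc_subset_Icc_self ht)]
    simp [e]
  · intro t ht
    have : u t = 0 := image_eq_zero_of_notMem_tsupport fun hmem =>
      ht (Ioo_subset_Ioc_self (hsupp hmem))
    simp [this]

/-- A vector of the plane orthogonal to `B` and to a vector that is not a multiple of `B`
vanishes. -/
theorem Plane.eq_zero_of_inner_eq_zero {q B Y : Plane} (hB : B ≠ 0) (hY : ∀ γ : ℝ, Y ≠ γ • B)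
    (h₁ : ⟪q, B⟫_ℝ = 0) (h₂ : ⟪q, Y⟫_ℝ = 0) : q = 0 := by
  have hli : LinearIndependent ℝ ![B, Y] :=
    (LinearIndependent.pair_iff' hB).2 fun γ h => hY γ h.symm
  have hspan := hli.span_eq_top_of_card_eq_finrank (by simp)
  refine (inner_self_eq_zero (𝕜 := ℝ)).1 ?_
  have hq : q ∈ Submodule.span ℝ (range ![B, Y]) := hspan ▸ Submodule.mem_top
  refine Submodule.span_induction (p := fun y _ => ⟪q, y⟫_ℝ = 0) ?_ (inner_zero_right q)
    (fun a b _ _ ha hb => by rw [inner_add_right, ha, hb, add_zero])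
    (fun c a _ ha => by rw [inner_smul_right, ha, mul_zero]) hq
  rintro _ ⟨i, rfl⟩
  fin_cases i
  · exact h₁
  · exact h₂

section Adjoint

variable {E : Type*} [NormedAddCommGroup E] [InnerProductSpace ℝ E] [CompleteSpace E]

/-- `q` solves the adjoint of the linearization of `dx/dt = C(x)` along the curve `x`. -/
def IsAdjointCurve (C : E → E) (T : ℝ) (x q : ℝ → E) : Prop :=
  ∀ t ∈ Icc 0 T, HasDerivWithinAt q (-(fderiv ℝ C (x t)).adjoint (q t)) (Icc 0 T) t

theorem exists_isAdjointCurve {C : E → E} (hC1 : ContDiff ℝ 1 C) {K : ℝ≥0}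
    (hC : LipschitzWith K C) {T : ℝ} (hT : 0 ≤ T) {x : ℝ → E} (hx : ContinuousOn x (Icc 0 T))
    (p : E) : ∃ q, q T = p ∧ IsAdjointCurve C T x q := by
  have hL : Continuous fun t => (fderiv ℝ C (x (projIcc 0 T hT t))).adjoint :=
    (ContinuousLinearMap.adjoint (𝕜 := ℝ) (E := E) (F := E)).continuous.comp
      ((hC1.continuous_fderiv one_ne_zero).comp (hx.comp_continuous
        (continuous_subtype_val.comp continuous_projIcc) fun t => Subtype.prop _))
  obtain ⟨q, hqT, hq⟩ := exists_solution_of_lipschitzWith hT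
    (F := fun t q => -(fderiv ℝ C (x (projIcc 0 T hT t))).adjoint q) (K := K)
    (((hL.comp continuous_fst).clm_apply continuous_snd).neg)
    (fun t => LipschitzWith.of_dist_le_mul fun y z => by
      rw [dist_neg_neg, dist_eq_norm, dist_eq_norm, ← map_sub]
      refine (ContinuousLinearMap.le_opNorm _ _).trans
        (mul_le_mul_of_nonneg_right ?_ (norm_nonneg _))
      rw [LinearIsometryEquiv.norm_map]
      exact norm_fderiv_le_of_lipschitz ℝ hC)
    (right_mem_Icc.2 hT) p
  refine ⟨q, hqT, fun t ht => ?_⟩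
  have h := hq t ht
  rwa [projIcc_of_mem hT ht] at h

namespace IsAdjointCurve

variable {C : E → E} {T : ℝ} {x q : ℝ → E}

theorem continuousOn (hq : IsAdjointCurve C T x q) : ContinuousOn q (Icc 0 T) :=
  fun t ht => (hq t ht).continuousWithinAt

/-- The adjoint equation is linear and homogeneous, so a zero at time `t` would persist up to `T`.
-/
theorem ne_zero {K : ℝ≥0} (hC : LipschitzWith K C) (hq : IsAdjointCurve C T x q)
    (hqT : q T ≠ 0) {t : ℝ} (ht : t ∈ Icc 0 T) : q t ≠ 0 := by
  intro h0
  refine hqT (eq_zero_of_abs_deriv_le_mul_abs_self_of_eq_zero_right (K := K)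
    (f' := fun s => -(fderiv ℝ C (x s)).adjoint (q s))
    (hq.continuousOn.mono (Icc_subset_Icc_left ht.1)) (fun s hs => ?_) h0 (fun s _ => ?_) T
    (right_mem_Icc.2 ht.2))
  · have hs' : s ∈ Ico 0 T := ⟨ht.1.trans hs.1, hs.2⟩
    exact (hq s (Ico_subset_Icc_self hs')).mono_of_mem_nhdsWithin (Icc_mem_nhdsGE_of_mem hs')
  · rw [norm_neg]
    refine (ContinuousLinearMap.le_opNorm _ _).trans
      (mul_le_mul_of_nonneg_right ?_ (norm_nonneg _))
    rw [LinearIsometryEquiv.norm_map]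
    exact norm_fderiv_le_of_lipschitz ℝ hC

/-- Duality between variations and adjoint curves. -/
theorem inner_variation {B : E} (hT : 0 ≤ T) (hq : IsAdjointCurve C T x q) {v : SmoothControl T}
    {z : ℝ → E} (hz : IsVariation C B T x v z) :
    ⟪q T, z T⟫_ℝ =
      ∫ t in (0 : ℝ)..T, (v : C(Icc (0 : ℝ) T, ℝ)) (projIcc 0 T hT t) * ⟪q t, B⟫_ℝ := by
  have hint : ContinuousOn
      (fun t => (v : C(Icc (0 : ℝ) T, ℝ)) (projIcc 0 T hT t) * ⟪q t, B⟫_ℝ) (Icc 0 T) :=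
    ((v : C(Icc (0 : ℝ) T, ℝ)).continuous.comp continuous_projIcc).continuousOn.mul
      (hq.continuousOn.inner continuousOn_const)
  rw [intervalIntegral.integral_eq_sub_of_hasDerivAt_of_le (f := fun t => ⟪q t, z t⟫_ℝ) hT
    (hq.continuousOn.inner hz.continuousOn) (fun t ht => ?_)
    (ContinuousOn.intervalIntegrable (by rwa [uIcc_of_le hT])), hz.1, inner_zero_right, sub_zero]
  have ht' := Ioo_subset_Icc_self ht
  have hn : Icc 0 T ∈ 𝓝 t := Icc_mem_nhds ht.1 ht.2
  refine (((hq t ht').hasDerivAt hn).inner ℝ ((hz.2 ⟨t, ht'⟩).hasDerivAt hn)).congr_deriv ?_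
  -- The two terms with `DC(x)` cancel; only the control term survives.
  rw [projIcc_of_mem hT ht', inner_add_right, inner_neg_left,
    ContinuousLinearMap.adjoint_inner_left, inner_smul_right]
  ring

/-- If `⟨q, B⟩` vanishes on the whole interval, then so does `⟨q, DC(x) B⟩`. -/
theorem inner_fderiv_eq_zero {B : E} (hq : IsAdjointCurve C T x q)
    (hB : EqOn (fun t => ⟪q t, B⟫_ℝ) 0 (Ioo 0 T)) {t : ℝ} (ht : t ∈ Ioo 0 T) :
    ⟪q t, fderiv ℝ C (x t) B⟫_ℝ = 0 := by
  have h₁ := ((hq t (Ioo_subset_Icc_self ht)).hasDerivAt (Icc_mem_nhds ht.1 ht.2)).inner ℝ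
    (hasDerivAt_const t B)
  have h₂ : HasDerivAt (fun t => ⟪q t, B⟫_ℝ) 0 t :=
    (hasDerivAt_const t (0 : ℝ)).congr_of_eventuallyEq
      (Filter.eventuallyEq_of_mem (isOpen_Ioo.mem_nhds ht) hB)
  have h := h₁.unique h₂
  rwa [inner_zero_right, zero_add, inner_neg_left, ContinuousLinearMap.adjoint_inner_left,
    neg_eq_zero] at h

end IsAdjointCurve

end Adjoint

/-- The planar system `dx/dt = C(x) + w B` has no singular controls if `B` is nowhere an
eigenvector of `DC`. -/
theorem isLocallyControllable_of_forall_fderiv_ne_smul {C : Plane → Plane}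
    (hC1 : ContDiff ℝ 1 C) {K : ℝ≥0} (hC : LipschitzWith K C) {B : Plane} (hB : B ≠ 0)
    (hne : ∀ (x : Plane) (γ : ℝ), fderiv ℝ C x B ≠ γ • B) {T : ℝ} (hT : 0 < T) (x₀ : Plane) :
    IsLocallyControllable (fun x u => C x + u • B) T x₀ := by
  have key (w : SmoothControl T) : ∃ D : SmoothControl T →L[ℝ] Plane,
      HasFDerivAt (endpointMap (fun x u => C x + u • B) T x₀) D w ∧ Function.Surjective D := by
    obtain ⟨x, hx, -⟩ := hasUniqueTrajectories_of_lipschitzWith hC B hT.le x₀ w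
    obtain ⟨D, hD⟩ := exists_variationEndpoint hC1 hC B hT.le hx.continuousOn
    refine ⟨D, hasFDerivAt_endpointMap hC1 hC hT.le hx hD, ?_⟩
    change Function.Surjective (D : SmoothControl T →ₗ[ℝ] Plane)
    rw [← LinearMap.range_eq_top, ← Submodule.orthogonal_eq_bot_iff, Submodule.eq_bot_iff]
    intro p hp
    by_contra hp0
    obtain ⟨q, hqT, hq⟩ := exists_isAdjointCurve hC1 hC hT.le hx.continuousOn p
    have hzero : EqOn (fun t => ⟪q t, B⟫_ℝ) 0 (Ioo 0 T) := by
      refine eqOn_zero_of_forall_integral_smoothControl hT.le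
        (hq.continuousOn.inner continuousOn_const) fun v => ?_
      obtain ⟨z, hz⟩ := IsVariation.exists_of_continuousOn hC1 hC B hT.le hx.continuousOn v
      rw [← hq.inner_variation hT.le hz, hqT, ← hD v z hz]
      exact Submodule.inner_left_of_mem_orthogonal (LinearMap.mem_range_self _ v) hp
    have hmid : T / 2 ∈ Ioo 0 T := ⟨by linarith, by linarith⟩
    exact hq.ne_zero hC (hqT ▸ hp0) (Ioo_subset_Icc_self hmid)
      (Plane.eq_zero_of_inner_eq_zero hB (hne (x (T / 2))) (hzero hmid)
        (hq.inner_fderiv_eq_zero hzero hmid))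
  refine ⟨fun w => ?_, fun w hw => ?_⟩
  · obtain ⟨D, hD, -⟩ := key w
    exact hD.differentiableAt
  · obtain ⟨D, hD, hsurj⟩ := key w
    exact hw (by rw [hD.fderiv]; exact hsurj)

end Controllability

theorem mainTheorem2
    (A : Plane →L[ℝ] Plane) (B : Plane) (f : Plane → Plane)
    (hf : ContDiff ℝ ∞ f)
    (hAB : IsGloballyControllable fun (x : Plane) (u : ℝ) => A x + u • B)
    (hbdd : BddAbove (Set.range fun x : Plane => ‖fderiv ℝ f x‖))
    (hsup : (⨆ x : Plane, ‖fderiv ℝ f x‖) < minGap A B / ‖B‖) :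
    (∀ (x : Plane) (γ : ℝ),
      ¬ Module.End.HasEigenvector
        ((A + fderiv ℝ f x : Plane →L[ℝ] Plane) : Plane →ₗ[ℝ] Plane) γ B) ∧
    ∀ (T : ℝ), 0 < T → ∀ x₀ : Plane,
      HasUniqueTrajectories (fun (x : Plane) (u : ℝ) => A x + u • B + f x) T x₀ ∧
      IsLocallyControllable (fun (x : Plane) (u : ℝ) => A x + u • B + f x) T x₀ := by
  have hle (x : Plane) : ‖fderiv ℝ f x‖ ≤ ⨆ x : Plane, ‖fderiv ℝ f x‖ := le_ciSup hbdd x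
  have hB : B ≠ 0 := by
    -- For `B = 0` the quotient is `0` by the convention for division, and a supremum of norms is
    -- not negative.
    rintro rfl
    rw [norm_zero, div_zero] at hsup
    exact absurd ((norm_nonneg _).trans (hle 0)) hsup.not_ge
  have hBpos : 0 < ‖B‖ := norm_pos_iff.2 hB
  have hne (x : Plane) (γ : ℝ) : A B + fderiv ℝ f x B ≠ γ • B := by
    intro h
    have h₁ : ‖A B - γ • B‖ = ‖fderiv ℝ f x B‖ := by
      rw [← h, sub_add_cancel_left, norm_neg]
    have h₂ := (lt_div_iff₀ hBpos).1 ((hle x).trans_lt hsup)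
    exact absurd ((fderiv ℝ f x).le_opNorm B)
      (h₁ ▸ h₂.trans_le ((minGap_isMin A B).2 γ)).not_ge
  refine ⟨fun x γ h => hne x γ h.apply_eq_smul, fun T hT x₀ => ?_⟩
  have hfd : Differentiable ℝ f := hf.differentiable (by simp)
  have hderiv (x : Plane) : fderiv ℝ (fun x => A x + f x) x = A + fderiv ℝ f x :=
    (A.hasFDerivAt.add (hfd x).hasFDerivAt).fderiv
  have hC1 : ContDiff ℝ 1 fun x => A x + f x := A.contDiff.add (hf.of_le (by simp))
  have hC : LipschitzWith (‖A‖ + ⨆ x : Plane, ‖fderiv ℝ f x‖).toNNReal fun x => A x + f x := by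
    refine lipschitzWith_of_nnnorm_fderiv_le (𝕜 := ℝ) (hC1.differentiable one_ne_zero) fun x => ?_
    rw [← norm_toNNReal, hderiv]
    exact Real.toNNReal_le_toNNReal ((norm_add_le _ _).trans (by gcongr; exact hle x))
  have hsys : (fun (x : Plane) (u : ℝ) => A x + u • B + f x) =
      fun x u => (A x + f x) + u • B := by
    funext x u
    exact add_right_comm _ _ _
  rw [hsys]
  refine ⟨hasUniqueTrajectories_of_lipschitzWith hC B hT.le x₀,
    isLocallyControllable_of_forall_fderiv_ne_smul hC1 hC hB (fun x γ => ?_) hT x₀⟩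
  rw [hderiv]
  exact hne x γ
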